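/- Let $\tau\in\mathbb C$ with $y=\operatorname{Im}\tau>0$, let $\Lambda=\mathbb Z\oplus\mathbb Z\tau\subset\mathbb C$, and let $\psi$ be a character of $\Lambda$ (a homomorphism from $\Lambda$ to the unit circle). Let $u,v\in\mathbb R$, not both integers, be such that $\psi(\tau)=e^{2\pi i u}$ and $\psi(1)=e^{2\pi i v}$; that is, $\psi(m\tau+n)=e^{2\pi i(mu+nv)}$ for all $m,n\in\mathbb Z$. Then the limit $$L(\Lambda,\psi)=\lim_{x\to\infty}\ \sum_{\substack{\mu\in\Lambda\\ 0<|\mu|^2\le x}}\frac{\psi(\mu)}{|\mu|^2}$$ exists, and $$L(\Lambda,\psi)=-\frac{2\pi}{y}\,\log\left|g_{-v,u}(\tau)\right|.$$ Here $g_{a_1,a_2}$, for $a_1,a_2\in\mathbb R$, is the Siegel function $$g_{a_1,a_2}(\tau)=-q_\tau^{B_2(a_1)/2}\,e^{2\pi i a_2(a_1-1)/2}\,(1-q_z)\prod_{n=1}^{\infty}(1-q_\tau^n q_z)(1-q_\tau^n/q_z),$$ where $B_2(X)=X^2-X+\tfrac16$, $z=a_1\tau+a_2$, $q_z=e^{2\pi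 i z}$, $q_\tau=e^{2\pi i\tau}$ and $q_\tau^{c}=e^{2\pi i c\tau}$ for $c\in\mathbb R$. -/

import Mathlib

open Filter Topology
open scoped UpperHalfPlane

namespace LatticeSum

/-- The lattice `Λ = ℤ ⊕ ℤτ ⊂ ℂ`, for `τ` in the upper half-plane. -/
def lattice (τ : ℍ) : AddSubgroup ℂ := AddSubgroup.closure {1, (τ : ℂ)}

theorem one_mem_lattice (τ : ℍ) : (1 : ℂ) ∈ lattice τ :=
  AddSubgroup.subset_closure (by simp)

theorem tau_mem_lattice (τ : ℍ) : (τ : ℂ) ∈ lattice τ :=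
  AddSubgroup.subset_closure (by simp)

/-- The element `1` of the lattice `ℤ ⊕ ℤτ`. -/
def oneΛ (τ : ℍ) : lattice τ := ⟨1, one_mem_lattice τ⟩

/-- The element `τ` of the lattice `ℤ ⊕ ℤτ`. -/
def tauΛ (τ : ℍ) : lattice τ := ⟨τ, tau_mem_lattice τ⟩

/-- There are only finitely many nonzero lattice points `μ` with `|μ|² ≤ x`. -/
theorem finite_lattice_disc (τ : ℍ) (x : ℝ) :
    {μ : lattice τ | μ ≠ 0 ∧ ‖(μ : ℂ)‖ ^ 2 ≤ x}.Finite := by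
  have hy := τ.im_pos
  set R : ℝ := Real.sqrt x
  set M : ℤ := ⌈R / τ.im⌉
  set N : ℤ := ⌈R + M * |τ.re|⌉
  refine Set.Finite.of_finite_image (f := fun μ : lattice τ => (μ : ℂ)) ?_
    Subtype.val_injective.injOn
  refine ((((Set.finite_Icc (-M) M).prod (Set.finite_Icc (-N) N)).image
    (fun p : ℤ × ℤ => (p.2 : ℂ) + (p.1 : ℂ) * (τ : ℂ)))).subset ?_
  rintro _ ⟨⟨μ, hμ⟩, ⟨-, hx⟩, rfl⟩
  obtain ⟨n, m, rfl⟩ := AddSubgroup.mem_closure_pair.1 hμ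
  have hR : ‖(n • (1 : ℂ) + m • (τ : ℂ))‖ ≤ R := Real.le_sqrt_of_sq_le hx
  have him := (Complex.abs_im_le_norm _).trans hR
  have hre := (Complex.abs_re_le_norm _).trans hR
  simp only [zsmul_eq_mul, mul_one, Complex.add_im, Complex.intCast_im, Complex.mul_im,
    Complex.intCast_re, zero_mul, add_zero, zero_add, Complex.add_re, Complex.mul_re, sub_zero,
    UpperHalfPlane.coe_im, UpperHalfPlane.coe_re] at him hre
  have hm : |(m : ℝ)| ≤ M := by
    rw [abs_mul, abs_of_pos hy] at him
    exact ((le_div_iff₀ hy).2 him).trans (Int.le_ceil _)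
  have hn : |(n : ℝ)| ≤ N := by
    have h1 : |(m : ℝ) * τ.re| ≤ M * |τ.re| := by
      rw [abs_mul]; exact mul_le_mul_of_nonneg_right hm (abs_nonneg _)
    have h2 : |(n : ℝ)| ≤ |(n : ℝ) + m * τ.re| + |(m : ℝ) * τ.re| := by
      simpa using abs_sub ((n : ℝ) + m * τ.re) (m * τ.re)
    exact (h2.trans (add_le_add hre h1)).trans (Int.le_ceil _)
  refine ⟨(m, n), ⟨?_, ?_⟩, by simp⟩
  · exact abs_le.1 (by exact_mod_cast hm)
  · exact abs_le.1 (by exact_mod_cast hn)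

/-- `Z(x, Λ, ψ) = ∑ ψ(μ) / |μ|²`, summed over the `μ ∈ Λ` with `μ ≠ 0` and `|μ|² ≤ x`.
A character of `Λ` (a one-dimensional unitary representation) is a homomorphism
from `Λ` to the unit circle. -/
noncomputable def Z (τ : ℍ) (ψ : AddChar (lattice τ) Circle) (x : ℝ) : ℂ :=
  ∑ μ ∈ (finite_lattice_disc τ x).toFinset, (ψ μ : ℂ) / ((‖(μ : ℂ)‖ ^ 2 : ℝ) : ℂ)

/-- `L(Λ, ψ) = lim_{x → ∞} Z(x, Λ, ψ)`; this is meaningful when the limit exists. -/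
noncomputable def L (τ : ℍ) (ψ : AddChar (lattice τ) Circle) : ℂ :=
  limUnder atTop (Z τ ψ)

/-- `B₂(X) = X² - X + 1/6`. -/
noncomputable def B₂ (X : ℝ) : ℝ := X ^ 2 - X + 1 / 6

/-- `e(w) = exp(2πiw)`. -/
noncomputable def e (w : ℂ) : ℂ := Complex.exp (2 * Real.pi * Complex.I * w)

/-- The Siegel function: with `z = a₁τ + a₂`, `q_τ = e(τ)`, `q_z = e(z)`,
`g_{a₁,a₂}(τ) = -q_τ^{B₂(a₁)/2} e(a₂(a₁-1)/2) (1 - q_z) ∏_{n ≥ 1} (1 - q_τⁿ q_z)(1 - q_τⁿ / q_z)`,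
where `q_τ^c` means `e(cτ)`. -/
noncomputable def siegel (a₁ a₂ : ℝ) (τ : ℍ) : ℂ :=
  -e ((B₂ a₁ / 2 : ℝ) * τ) * e ((a₂ * (a₁ - 1) / 2 : ℝ)) * (1 - e (a₁ * τ + a₂)) *
    ∏' n : ℕ, ((1 - e τ ^ (n + 1) * e (a₁ * τ + a₂)) * (1 - e τ ^ (n + 1) / e (a₁ * τ + a₂)))

end LatticeSum

namespace LatticeSum

/-! The series is only conditionally convergent, so the first task is to replace summation over
discs by summation over rows. On the row of index `m ≠ 0` the weights `1/|mτ+n|²`, even after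
truncation to a disc, rise to a single peak and then fall. If `v` is not an integer, Abel summation
bounds the row by a constant times `1/m²`, uniformly in the radius, and dominated convergence gives
the limit (`tendsto_tsum_truncTerm`).

Each row is then a Fourier series in `v`: `hasSum_row` for `m ≠ 0`, a Bernoulli polynomial for `m =
0`. Summed over `m`, the rows become logarithms of two Euler products (`hasSum_log_eulerProd`), and
together with the Bernoulli term they make up `log ‖siegel (-v) u τ‖` (`log_norm_siegel`).

If `v` is an integer then `u` is not, and the disc limit is a sum by columns. That sum is continuous
in `v` and agrees with the row sum on `(0, 1)`, so the formula extends to `v = 0` by letting `v →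
0⁺`. Periodicity in `v` of both sides handles the other integers. -/

/-! ### Abel summation for character sums. -/

theorem norm_one_sub_mul_sum_range_le {z : ℂ} (hz : ‖z‖ = 1) {a : ℕ → ℝ} (ha : Antitone a)
    (h0 : ∀ k, 0 ≤ a k) (N : ℕ) :
    ‖(1 - z) * ∑ k ∈ Finset.range N, z ^ k * (a k : ℂ)‖ ≤ 2 * a 0 := by
  -- With the boundary term added, passing from `N` to `N + 1` changes the left side by `z ^ (N + 1)
  -- * (a (N + 1) - a N)`, and the norms of these increments telescope.
  have key : ∀ N : ℕ, ‖(1 - z) * ∑ k ∈ Finset.range (N + 1), z ^ k * (a k : ℂ)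
      + z ^ (N + 1) * a N‖ ≤ 2 * a 0 - a N := by
    intro N
    induction N with
    | zero =>
      have : (1 - z) * ∑ k ∈ Finset.range (0 + 1), z ^ k * (a k : ℂ) + z ^ (0 + 1) * a 0
          = (a 0 : ℂ) := by simp; ring
      rw [this, Complex.norm_real, Real.norm_of_nonneg (h0 0)]
      linarith
    | succ N ih =>
      have e : (1 - z) * ∑ k ∈ Finset.range (N + 1 + 1), z ^ k * (a k : ℂ)
          + z ^ (N + 1 + 1) * a (N + 1)
          = ((1 - z) * ∑ k ∈ Finset.range (N + 1), z ^ k * (a k : ℂ) + z ^ (N + 1) * a N)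
            + z ^ (N + 1) * ((a (N + 1) - a N : ℝ) : ℂ) := by
        rw [Finset.sum_range_succ _ (N + 1)]; push_cast; ring
      have hle := ha (Nat.le_succ N)
      have h2 : ‖z ^ (N + 1) * ((a (N + 1) - a N : ℝ) : ℂ)‖ = a N - a (N + 1) := by
        rw [norm_mul, norm_pow, hz, one_pow, one_mul, Complex.norm_real,
          Real.norm_of_nonpos (by linarith), neg_sub]
      rw [e]
      refine (norm_add_le _ _).trans ?_
      rw [h2]
      linarith
  cases N with
  | zero => simpa using h0 0
  | succ N =>
    have h := key N
    have h2 : ‖z ^ (N + 1) * (a N : ℂ)‖ = a N := by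
      rw [norm_mul, norm_pow, hz, one_pow, one_mul, Complex.norm_real, Real.norm_of_nonneg (h0 N)]
    have h3 := norm_sub_le ((1 - z) * ∑ k ∈ Finset.range (N + 1), z ^ k * (a k : ℂ)
      + z ^ (N + 1) * a N) (z ^ (N + 1) * a N)
    rw [add_sub_cancel_right, h2] at h3
    linarith

theorem norm_one_sub_mul_tsum_le {z : ℂ} (hz : ‖z‖ = 1) {a : ℕ → ℝ} (ha : Antitone a)
    (h0 : ∀ k, 0 ≤ a k) (hs : Summable a) :
    ‖1 - z‖ * ‖∑' k, z ^ k * (a k : ℂ)‖ ≤ 2 * a 0 := by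
  have hs' : Summable fun k => z ^ k * (a k : ℂ) := by
    refine Summable.of_norm ?_
    simpa [norm_mul, hz] using hs.norm
  rw [← norm_mul]
  refine le_of_tendsto ((hs'.hasSum.tendsto_sum_nat.const_mul (1 - z)).norm)
    (Eventually.of_forall fun N => norm_one_sub_mul_sum_range_le hz ha h0 N)

/-- A bound for character sums over `ℤ` with unimodal weights. -/
theorem norm_one_sub_mul_tsum_int_le {z : ℂ} (hz : ‖z‖ = 1) {F : ℤ → ℝ} (h0 : ∀ n, 0 ≤ F n)
    (hs : Summable F) {B : ℝ} (hB : ∀ n, F n ≤ B) {n₀ : ℤ}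
    (hl : ∀ m n, m ≤ n → n ≤ n₀ → F m ≤ F n) (hr : ∀ m n, n₀ < m → m ≤ n → F n ≤ F m) :
    ‖1 - z‖ * ‖∑' n : ℤ, z ^ n * (F n : ℂ)‖ ≤ 4 * B := by
  have hz0 : z ≠ 0 := by rintro rfl; simp at hz
  -- Cut at the peak `n₀`. Both halves are antitone when read away from it, the left one with `z⁻¹`
  -- in place of `z`, and each contributes at most `2 * B`.
  have hs₁ : Summable fun k : ℕ => F (k + (n₀ + 1)) :=
    hs.comp_injective (i := fun k : ℕ => (k : ℤ) + (n₀ + 1)) fun a b h => by simpa using h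
  have hs₂ : Summable fun k : ℕ => F (n₀ - k) :=
    hs.comp_injective (i := fun k : ℕ => n₀ - (k : ℤ)) fun a b h => by simpa using h
  have e₁ : ∀ k : ℕ, z ^ ((k : ℤ) + (n₀ + 1)) * (F (k + (n₀ + 1)) : ℂ)
      = z ^ (n₀ + 1) * (z ^ k * (F (k + (n₀ + 1)) : ℂ)) := fun k => by
    rw [zpow_add₀ hz0, zpow_natCast]; ring
  have e₂ : ∀ k : ℕ, z ^ (-((k : ℤ) + 1) + (n₀ + 1)) * (F (-((k : ℤ) + 1) + (n₀ + 1)) : ℂ)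
      = z ^ n₀ * (z⁻¹ ^ k * (F (n₀ - k) : ℂ)) := fun k => by
    rw [show -((k : ℤ) + 1) + (n₀ + 1) = n₀ - k by ring, zpow_sub₀ hz0, zpow_natCast, inv_pow]
    ring
  have hz' : ‖z⁻¹‖ = 1 := by rw [norm_inv, hz, inv_one]
  have hzz : ‖1 - z⁻¹‖ = ‖1 - z‖ := by
    rw [show 1 - z⁻¹ = -(z⁻¹ * (1 - z)) by field_simp; ring, norm_neg, norm_mul, hz', one_mul]
  have b₁ := norm_one_sub_mul_tsum_le hz (a := fun k : ℕ => F (k + (n₀ + 1)))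
    (fun i j h => hr _ _ (by omega) (by omega)) (fun _ => h0 _) hs₁
  have b₂ := norm_one_sub_mul_tsum_le hz' (a := fun k : ℕ => F (n₀ - k))
    (fun i j h => hl _ _ (by omega) (by omega)) (fun _ => h0 _) hs₂
  rw [hzz] at b₂
  have split : ∑' n : ℤ, z ^ n * (F n : ℂ)
      = z ^ (n₀ + 1) * (∑' k : ℕ, z ^ k * (F (k + (n₀ + 1)) : ℂ))
        + z ^ n₀ * ∑' k : ℕ, z⁻¹ ^ k * (F (n₀ - k) : ℂ) := by
    rw [← (Equiv.addRight (n₀ + 1)).tsum_eq (fun n : ℤ => z ^ n * (F n : ℂ))]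
    simp only [Equiv.coe_addRight]
    rw [tsum_of_nat_of_neg_add_one, ← tsum_mul_left, ← tsum_mul_left]
    · simp_rw [e₁, e₂]
    · simp_rw [e₁]
      refine Summable.mul_left _ (Summable.of_norm ?_)
      simpa [norm_mul, hz] using hs₁.norm
    · simp_rw [e₂]
      refine Summable.mul_left _ (Summable.of_norm ?_)
      simpa [norm_mul, hz] using hs₂.norm
  rw [split]
  have h3 := norm_add_le (z ^ (n₀ + 1) * (∑' k : ℕ, z ^ k * (F (k + (n₀ + 1)) : ℂ)))
    (z ^ n₀ * ∑' k : ℕ, z⁻¹ ^ k * (F (n₀ - k) : ℂ))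
  rw [norm_mul, norm_mul, norm_zpow, norm_zpow, hz, one_zpow, one_zpow, one_mul, one_mul] at h3
  have h4 := mul_le_mul_of_nonneg_left h3 (norm_nonneg (1 - z))
  rw [mul_add] at h4
  exact h4.trans ((add_le_add (b₁.trans (mul_le_mul_of_nonneg_left (hB _) zero_le_two))
    (b₂.trans (mul_le_mul_of_nonneg_left (hB _) zero_le_two))).trans_eq (by ring))

/-! ### Summation over discs and summation by rows. -/

theorem summable_one_div_one_add_int_sq : Summable fun n : ℤ => 1 / (1 + (n : ℝ) ^ 2) := by
  refine Summable.of_norm_bounded_eventually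
    (Real.summable_one_div_int_pow.2 (one_lt_two)) ?_
  rw [eventually_cofinite]
  refine (Set.finite_singleton (0 : ℤ)).subset fun n hn => ?_
  by_contra h
  refine hn ?_
  have hn0 : (n : ℝ) ≠ 0 := by exact_mod_cast h
  have : 0 < (n : ℝ) ^ 2 := by positivity
  rw [Real.norm_of_nonneg (by positivity)]
  exact one_div_le_one_div_of_le this (by linarith)

/-- The terms of the truncated lattice sum, for the lattice with basis `a, b`. -/
noncomputable def truncTerm (a b ζ ξ : ℂ) (x : ℝ) (m n : ℤ) : ℂ :=
  if ‖m * a + n * b‖ ^ 2 ≤ x then ζ ^ m * ξ ^ n / ((‖m * a + n * b‖ ^ 2 : ℝ) : ℂ) else 0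

/-- The sum over one row of the lattice. -/
noncomputable def rowSum (a b ξ : ℂ) (m : ℤ) : ℂ :=
  ∑' n : ℤ, ξ ^ n / ((‖m * a + n * b‖ ^ 2 : ℝ) : ℂ)

/-- Away from the origin `m² + n² ≥ (1 + n²)/2`, whence the constant `2 / c`; at the origin the left
side is `1 / 0 = 0`. -/
theorem one_div_norm_sq_le {a b : ℂ} {c : ℝ} (hc : 0 < c)
    (hab : ∀ m n : ℤ, c * ((m : ℝ) ^ 2 + (n : ℝ) ^ 2) ≤ ‖m * a + n * b‖ ^ 2)
    (m n : ℤ) :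
    1 / ‖m * a + n * b‖ ^ 2 ≤ 2 / c * (1 / (1 + (n : ℝ) ^ 2)) := by
  by_cases h : m = 0 ∧ n = 0
  · obtain ⟨rfl, rfl⟩ := h
    simpa using by positivity
  · have h1 : (1 : ℝ) ≤ (m : ℝ) ^ 2 + (n : ℝ) ^ 2 := by
      have : (1 : ℤ) ≤ m ^ 2 + n ^ 2 := by
        rcases not_and_or.1 h with h | h
        · have := Int.one_le_abs h
          nlinarith [sq_abs m, sq_nonneg n]
        · have := Int.one_le_abs h
          nlinarith [sq_abs n, sq_nonneg m]
      exact_mod_cast this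
    have h2 : c / 2 * (1 + (n : ℝ) ^ 2) ≤ ‖m * a + n * b‖ ^ 2 := by
      refine le_trans ?_ (hab m n)
      nlinarith [sq_nonneg (m : ℝ)]
    refine (one_div_le_one_div_of_le (by positivity) h2).trans (le_of_eq ?_)
    field_simp

theorem norm_truncTerm_le {a b : ℂ} {c : ℝ} (hc : 0 < c)
    (hab : ∀ m n : ℤ, c * ((m : ℝ) ^ 2 + (n : ℝ) ^ 2) ≤ ‖m * a + n * b‖ ^ 2)
    {ζ ξ : ℂ} (hζ : ‖ζ‖ = 1) (hξ : ‖ξ‖ = 1) (x : ℝ) (m n : ℤ) :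
    ‖truncTerm a b ζ ξ x m n‖ ≤ 2 / c * (1 / (1 + (n : ℝ) ^ 2)) := by
  rw [truncTerm]
  split_ifs
  · rw [norm_div, norm_mul, norm_zpow, norm_zpow, hζ, hξ, one_zpow, one_zpow, one_mul,
      Complex.norm_real, Real.norm_of_nonneg (by positivity)]
    exact one_div_norm_sq_le hc hab m n
  · rw [norm_zero]; positivity

theorem tendsto_row {a b : ℂ} {c : ℝ} (hc : 0 < c)
    (hab : ∀ m n : ℤ, c * ((m : ℝ) ^ 2 + (n : ℝ) ^ 2) ≤ ‖m * a + n * b‖ ^ 2)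
    {ζ ξ : ℂ} (hζ : ‖ζ‖ = 1) (hξ : ‖ξ‖ = 1) (m : ℤ) :
    Tendsto (fun x => ∑' n : ℤ, truncTerm a b ζ ξ x m n) atTop (𝓝 (ζ ^ m * rowSum a b ξ m)) := by
  rw [rowSum, ← tsum_mul_left]
  refine tendsto_tsum_of_dominated_convergence
    (summable_one_div_one_add_int_sq.mul_left (2 / c)) (fun n => ?_)
    (Eventually.of_forall fun x n => norm_truncTerm_le hc hab hζ hξ x m n)
  refine tendsto_const_nhds.congr' ?_
  filter_upwards [eventually_ge_atTop (‖m * a + n * b‖ ^ 2)] with x hx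
  rw [truncTerm, if_pos hx, mul_div_assoc]

/-- Along a row the squared norm is a quadratic in `n` with minimum at a real point `s`. Cutting off
at `x` keeps the weights unimodal about `s`, so the bound does not depend on `x`. -/
theorem norm_row_le_of_ne {a b : ℂ} {c : ℝ} (hc : 0 < c)
    (hab : ∀ m n : ℤ, c * ((m : ℝ) ^ 2 + (n : ℝ) ^ 2) ≤ ‖m * a + n * b‖ ^ 2)
    {ζ ξ : ℂ} (hζ : ‖ζ‖ = 1) (hξ : ‖ξ‖ = 1) (x : ℝ) {m : ℤ} (hm : m ≠ 0) :
    ‖1 - ξ‖ * ‖∑' n : ℤ, truncTerm a b ζ ξ x m n‖ ≤ 4 * (1 / (c * (m : ℝ) ^ 2)) := by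
  have hb : b ≠ 0 := by
    rintro rfl
    have := hab 0 1
    simp at this
    linarith
  have hm0 : (m : ℝ) ≠ 0 := by exact_mod_cast hm
  have hpos : ∀ n : ℤ, 0 < ‖m * a + n * b‖ ^ 2 := fun n =>
    lt_of_lt_of_le (by positivity) (hab m n)
  set F : ℤ → ℝ := fun n => if ‖m * a + n * b‖ ^ 2 ≤ x then 1 / ‖m * a + n * b‖ ^ 2 else 0
  have hF0 : ∀ n, 0 ≤ F n := fun n => by
    simp only [F]; split_ifs <;> positivity
  have hFs : Summable F := by
    refine Summable.of_nonneg_of_le hF0 (fun n => ?_)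
      (summable_one_div_one_add_int_sq.mul_left (2 / c))
    refine le_trans ?_ (one_div_norm_sq_le hc hab m n)
    simp only [F]; split_ifs
    · exact le_rfl
    · positivity
  have hFB : ∀ n, F n ≤ 1 / (c * (m : ℝ) ^ 2) := fun n => by
    have h1 : 1 / ‖m * a + n * b‖ ^ 2 ≤ 1 / (c * (m : ℝ) ^ 2) :=
      one_div_le_one_div_of_le (by positivity) (le_trans (by nlinarith [sq_nonneg (n : ℝ)]) (hab m n))
    simp only [F]; split_ifs
    · exact h1
    · positivity
  have hmono : ∀ {n k : ℤ}, ‖m * a + n * b‖ ^ 2 ≤ ‖m * a + k * b‖ ^ 2 → F k ≤ F n := by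
    intro n k h
    simp only [F]
    by_cases h1 : ‖m * a + k * b‖ ^ 2 ≤ x
    · rw [if_pos h1, if_pos (h.trans h1)]
      exact one_div_le_one_div_of_le (hpos n) h
    · rw [if_neg h1]
      exact hF0 n
  set s : ℝ := -(m * a / b).re
  have hQ : ∀ n : ℤ, ‖m * a + n * b‖ ^ 2
      = ‖b‖ ^ 2 * (((n : ℝ) - s) ^ 2 + (m * a / b).im ^ 2) := fun n => by
    rw [show (m : ℂ) * a + n * b = b * (m * a / b + n) by field_simp, norm_mul, mul_pow,
      ← Complex.normSq_eq_norm_sq (_ + _), Complex.normSq_apply]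
    simp only [Complex.add_re, Complex.add_im, Complex.intCast_re, Complex.intCast_im, s]
    ring
  have h := norm_one_sub_mul_tsum_int_le hξ hF0 hFs hFB (n₀ := ⌊s⌋) ?_ ?_
  · have e : ∀ n : ℤ, truncTerm a b ζ ξ x m n = ζ ^ m * (ξ ^ n * (F n : ℂ)) := fun n => by
      simp only [truncTerm, F]
      split_ifs
      · push_cast; ring
      · simp
    simp_rw [e]
    rw [tsum_mul_left, norm_mul, norm_zpow, hζ, one_zpow, one_mul]
    exact h
  · intro k n hkn hn
    refine hmono ?_
    rw [hQ, hQ]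
    have h1 : (k : ℝ) ≤ n := by exact_mod_cast hkn
    have h2 : (n : ℝ) ≤ s := (Int.cast_le.2 hn).trans (Int.floor_le s)
    gcongr ‖b‖ ^ 2 * (?_ + _)
    nlinarith
  · intro k n hk hkn
    refine hmono ?_
    rw [hQ, hQ]
    have h1 : (k : ℝ) ≤ n := by exact_mod_cast hkn
    have h2 : s < k := Int.floor_lt.1 hk
    gcongr ‖b‖ ^ 2 * (?_ + _)
    nlinarith

theorem exists_norm_row_le {a b : ℂ} {c : ℝ} (hc : 0 < c)
    (hab : ∀ m n : ℤ, c * ((m : ℝ) ^ 2 + (n : ℝ) ^ 2) ≤ ‖m * a + n * b‖ ^ 2)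
    {ξ : ℂ} (hξ : ‖ξ‖ = 1) (hξ1 : ξ ≠ 1) :
    ∃ K : ℝ, ∀ ζ : ℂ, ‖ζ‖ = 1 → ∀ (x : ℝ) (m : ℤ),
      ‖∑' n : ℤ, truncTerm a b ζ ξ x m n‖ ≤ K * (1 / (1 + (m : ℝ) ^ 2)) := by
  have hd : 0 < ‖1 - ξ‖ := norm_pos_iff.2 (sub_ne_zero.2 hξ1.symm)
  set S := ∑' n : ℤ, 2 / c * (1 / (1 + (n : ℝ) ^ 2))
  have hS : 0 ≤ S := tsum_nonneg fun n => by positivity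
  -- `S` bounds the row `m = 0` absolutely; for the others `1 + m² ≤ 2m²` turns the 4 of the Abel
  -- bound into 8.
  refine ⟨S + 8 / (c * ‖1 - ξ‖), fun ζ hζ x m => ?_⟩
  rcases eq_or_ne m 0 with rfl | hm
  · have : ‖∑' n : ℤ, truncTerm a b ζ ξ x 0 n‖ ≤ S :=
      tsum_of_norm_bounded (summable_one_div_one_add_int_sq.mul_left (2 / c)).hasSum
        fun n => norm_truncTerm_le hc hab hζ hξ x 0 n
    refine this.trans ?_
    have : 0 ≤ 8 / (c * ‖1 - ξ‖) := by positivity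
    simp
    linarith
  · have h := norm_row_le_of_ne hc hab hζ hξ x hm
    have h1 : (1 : ℝ) ≤ (m : ℝ) ^ 2 := by
      have := Int.one_le_abs hm
      have : (1 : ℤ) ≤ m ^ 2 := by nlinarith [sq_abs m]
      exact_mod_cast this
    have h2 : ‖∑' n : ℤ, truncTerm a b ζ ξ x m n‖ ≤ 4 / (c * ‖1 - ξ‖ * (m : ℝ) ^ 2) := by
      rw [le_div_iff₀ (by positivity)]
      rw [mul_one_div, le_div_iff₀ (by positivity)] at h
      linarith
    refine h2.trans ?_
    have h3 : 4 / (c * ‖1 - ξ‖ * (m : ℝ) ^ 2) ≤ 8 / (c * ‖1 - ξ‖) * (1 / (1 + (m : ℝ) ^ 2)) := by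
      rw [div_mul_div_comm, div_le_div_iff₀ (by positivity) (by positivity)]
      have : 0 < c * ‖1 - ξ‖ := by positivity
      nlinarith
    refine h3.trans ?_
    gcongr
    linarith

theorem exists_norm_rowSum_le {a b : ℂ} {c : ℝ} (hc : 0 < c)
    (hab : ∀ m n : ℤ, c * ((m : ℝ) ^ 2 + (n : ℝ) ^ 2) ≤ ‖m * a + n * b‖ ^ 2)
    {ξ : ℂ} (hξ : ‖ξ‖ = 1) (hξ1 : ξ ≠ 1) :
    ∃ K : ℝ, ∀ m : ℤ, ‖rowSum a b ξ m‖ ≤ K * (1 / (1 + (m : ℝ) ^ 2)) := by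
  obtain ⟨K, hK⟩ := exists_norm_row_le hc hab hξ hξ1
  refine ⟨K, fun m => ?_⟩
  have h := (tendsto_row hc hab (ζ := 1) (by simp) hξ m).norm
  simp only [one_zpow, one_mul] at h
  exact le_of_tendsto h (Eventually.of_forall fun x => hK 1 (by simp) x m)

theorem summable_truncTerm {a b : ℂ} {c : ℝ} (hc : 0 < c)
    (hab : ∀ m n : ℤ, c * ((m : ℝ) ^ 2 + (n : ℝ) ^ 2) ≤ ‖m * a + n * b‖ ^ 2)
    (ζ ξ : ℂ) (x : ℝ) :
    Summable fun p : ℤ × ℤ => truncTerm a b ζ ξ x p.1 p.2 := by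
  refine summable_of_hasFiniteSupport ?_
  set N : ℤ := ⌈x / c⌉
  refine ((Set.finite_Icc (-N) N).prod (Set.finite_Icc (-N) N)).subset fun p hp => ?_
  obtain ⟨m, n⟩ := p
  have hx : ‖m * a + n * b‖ ^ 2 ≤ x := by
    by_contra h
    exact hp (if_neg h)
  have h1 : (m : ℝ) ^ 2 + (n : ℝ) ^ 2 ≤ N := by
    refine le_trans ?_ (Int.le_ceil _)
    rw [le_div_iff₀ hc]
    linarith [hab m n]
  have h2 : m ^ 2 + n ^ 2 ≤ N := by exact_mod_cast h1
  have hm : |m| ≤ m ^ 2 := by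
    rw [← sq_abs]; nlinarith [abs_nonneg m, Int.le_self_sq |m|]
  have hn : |n| ≤ n ^ 2 := by
    rw [← sq_abs]; nlinarith [abs_nonneg n, Int.le_self_sq |n|]
  exact ⟨abs_le.1 (by nlinarith), abs_le.1 (by nlinarith)⟩

/-- Circular summation of a lattice sum agrees with summation by rows. -/
theorem tendsto_tsum_truncTerm {a b : ℂ} {c : ℝ} (hc : 0 < c)
    (hab : ∀ m n : ℤ, c * ((m : ℝ) ^ 2 + (n : ℝ) ^ 2) ≤ ‖m * a + n * b‖ ^ 2)
    {ζ ξ : ℂ} (hζ : ‖ζ‖ = 1) (hξ : ‖ξ‖ = 1) (hξ1 : ξ ≠ 1) :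
    Tendsto (fun x => ∑' p : ℤ × ℤ, truncTerm a b ζ ξ x p.1 p.2) atTop
      (𝓝 (∑' m : ℤ, ζ ^ m * rowSum a b ξ m)) := by
  obtain ⟨K, hK⟩ := exists_norm_row_le hc hab hξ hξ1
  have e : ∀ x, ∑' p : ℤ × ℤ, truncTerm a b ζ ξ x p.1 p.2
      = ∑' m : ℤ, ∑' n : ℤ, truncTerm a b ζ ξ x m n := fun x =>
    (summable_truncTerm hc hab ζ ξ x).tsum_prod
  simp_rw [e]
  exact tendsto_tsum_of_dominated_convergence (summable_one_div_one_add_int_sq.mul_left K)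
    (fun m => tendsto_row hc hab hζ hξ m) (Eventually.of_forall fun x m => hK ζ hζ x m)

/-! ### The exponential `e`. -/

theorem e_add (z w : ℂ) : e (z + w) = e z * e w := by
  rw [e, e, e, ← Complex.exp_add]; ring_nf

theorem e_ne_zero (z : ℂ) : e z ≠ 0 := Complex.exp_ne_zero _

theorem e_zero : e 0 = 1 := by simp [e]

theorem e_neg (z : ℂ) : e (-z) = (e z)⁻¹ := by
  rw [e, e, ← Complex.exp_neg]; ring_nf

theorem e_zpow (z : ℂ) (n : ℤ) : e z ^ n = e (n * z) := by
  rw [e, e, ← Complex.exp_int_mul]; ring_nf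

theorem e_pow (z : ℂ) (n : ℕ) : e z ^ n = e (n * z) := by
  rw [e, e, ← Complex.exp_nat_mul]; ring_nf

theorem norm_e (z : ℂ) : ‖e z‖ = Real.exp (-(2 * Real.pi * z.im)) := by
  rw [e, Complex.norm_exp]; simp

theorem norm_e_ofReal (t : ℝ) : ‖e t‖ = 1 := by simp [norm_e]

theorem norm_e_lt_one {z : ℂ} (hz : 0 < z.im) : ‖e z‖ < 1 := by
  rw [norm_e, Real.exp_lt_one_iff]
  have := Real.pi_pos
  nlinarith [mul_pos this hz]

theorem conj_e (z : ℂ) : (starRingEnd ℂ) (e z) = e (-(starRingEnd ℂ) z) := by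
  rw [e, e, ← Complex.exp_conj]; simp [Complex.conj_ofNat]

theorem e_int (n : ℤ) : e n = 1 := by
  rw [e, Complex.exp_eq_one_iff]; exact ⟨n, by ring⟩

theorem e_ofReal_eq_one_iff {t : ℝ} : e t = 1 ↔ ∃ n : ℤ, t = n := by
  constructor
  · intro h
    rw [e, Complex.exp_eq_one_iff] at h
    obtain ⟨n, hn⟩ := h
    refine ⟨n, ?_⟩
    have : (t : ℂ) = n := by
      have h2 := Complex.two_pi_I_ne_zero
      rw [mul_comm] at hn
      exact mul_right_cancel₀ h2 hn
    exact_mod_cast this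
  · rintro ⟨n, rfl⟩
    simpa using e_int n

theorem continuous_e : Continuous e := by
  unfold e; fun_prop

theorem integral_e_mul {c : ℂ} (hc : c ≠ 0) :
    ∫ t in (0 : ℝ)..1, e (c * t) = (e c - 1) / (2 * Real.pi * Complex.I * c) := by
  have h : 2 * Real.pi * Complex.I * c ≠ 0 := mul_ne_zero Complex.two_pi_I_ne_zero hc
  have := integral_exp_mul_complex (a := 0) (b := 1) h
  simp only [e, ← mul_assoc]
  simpa using this

/-! ### Evaluation of the rows by Fourier series. -/

/-- The function whose Fourier coefficients are proportional to `1 / ‖w + n‖²`. -/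
noncomputable def rowFun (w : ℂ) (t : ℝ) : ℂ :=
  e (w * (1 - t)) / (1 - e w) + e (-(starRingEnd ℂ) w * t) / (1 - e (-(starRingEnd ℂ) w))

theorem one_sub_ne_zero_of_norm_lt_one {z : ℂ} (hz : ‖z‖ < 1) : 1 - z ≠ 0 := by
  intro h
  rw [← sub_eq_zero.1 h] at hz
  simp at hz

theorem continuous_rowFun (w : ℂ) : Continuous (rowFun w) := by
  unfold rowFun
  have := continuous_e
  fun_prop

/-- Partial fractions: `1/‖w + n‖²` is `1/(w̄ + n) - 1/(w + n)` divided by `w - w̄ = 2i Im w`. Each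
exponential in `rowFun` yields one fraction, its denominator cancelling because `e n = 1`. -/
theorem integral_rowFun {w : ℂ} (hw : 0 < w.im) (n : ℤ) :
    ∫ t in (0 : ℝ)..1, e (-n * t) * rowFun w t = w.im / Real.pi * (1 / ((‖w + n‖ ^ 2 : ℝ) : ℂ)) := by
  have hw' : 0 < (-(starRingEnd ℂ) w).im := by simpa using hw
  have h1 := one_sub_ne_zero_of_norm_lt_one (norm_e_lt_one hw)
  have h2 := one_sub_ne_zero_of_norm_lt_one (norm_e_lt_one hw')
  have n1 : w + n ≠ 0 := fun h => by
    have := congrArg Complex.im h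
    simp at this; linarith
  have n2 : (starRingEnd ℂ) w + n ≠ 0 := fun h => by
    have := congrArg Complex.im h
    simp at this; linarith
  have hE : ∀ t : ℝ, e (-n * t) * rowFun w t
      = e w / (1 - e w) * e (-(w + n) * t)
        + 1 / (1 - e (-(starRingEnd ℂ) w)) * e (-((starRingEnd ℂ) w + n) * t) := fun t => by
    have a1 : e (-n * t) * e (w * (1 - t)) = e w * e (-(w + n) * t) := by
      rw [← e_add, ← e_add]; ring_nf
    have a2 : e (-n * t) * e (-(starRingEnd ℂ) w * t) = e (-((starRingEnd ℂ) w + n) * t) := by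
      rw [← e_add]; ring_nf
    rw [rowFun, mul_add, ← mul_div_assoc, ← mul_div_assoc, a1, a2]
    ring
  simp_rw [hE]
  have := continuous_e
  rw [intervalIntegral.integral_add (Continuous.intervalIntegrable (by fun_prop) _ _)
    (Continuous.intervalIntegrable (by fun_prop) _ _), intervalIntegral.integral_const_mul,
    intervalIntegral.integral_const_mul, integral_e_mul (neg_ne_zero.2 n1),
    integral_e_mul (neg_ne_zero.2 n2)]
  have e1 : e w * (e (-(w + n)) - 1) = 1 - e w := by
    rw [mul_sub, ← e_add, show w + -(w + n) = ((-n : ℤ) : ℂ) by push_cast; ring, e_int, mul_one]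
  have e2 : e (-((starRingEnd ℂ) w + n)) = e (-(starRingEnd ℂ) w) := by
    rw [show -((starRingEnd ℂ) w + n) = -(starRingEnd ℂ) w + ((-n : ℤ) : ℂ) by push_cast; ring,
      e_add, e_int, mul_one]
  have hns : ((‖w + n‖ ^ 2 : ℝ) : ℂ) = (w + n) * ((starRingEnd ℂ) w + n) := by
    rw [← Complex.normSq_eq_norm_sq, ← Complex.mul_conj]; simp
  have him : (w.im : ℂ) = (w - (starRingEnd ℂ) w) / (2 * Complex.I) := by
    rw [Complex.sub_conj]; push_cast; field_simp
  have hpi : (Real.pi : ℂ) ≠ 0 := Complex.ofReal_ne_zero.2 Real.pi_ne_zero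
  rw [hns, him, e2, div_mul_div_comm, e1]
  field_simp
  ring

theorem exists_lattice_bound {w : ℂ} (hw : 0 < w.im) : ∃ c : ℝ, 0 < c ∧
    ∀ m n : ℤ, c * ((m : ℝ) ^ 2 + (n : ℝ) ^ 2) ≤ ‖m * w + n * 1‖ ^ 2 := by
  have hD : 0 < 1 + 2 * w.re ^ 2 + 2 * w.im ^ 2 := by positivity
  -- The constant comes from `n² ≤ 2(m Re w + n)² + 2(m Re w)²`, whose slack is the square `(2m Re w
  -- + n)²`.
  refine ⟨w.im ^ 2 / (1 + 2 * w.re ^ 2 + 2 * w.im ^ 2), by positivity, fun m n => ?_⟩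
  have e1 : ‖m * w + n * 1‖ ^ 2 = (m * w.re + n) ^ 2 + ((m : ℝ) * w.im) ^ 2 := by
    rw [← Complex.normSq_eq_norm_sq, Complex.normSq_apply]
    simp only [Complex.add_re, Complex.add_im, Complex.mul_re, Complex.mul_im, Complex.intCast_re,
      Complex.intCast_im, mul_one, zero_mul, sub_zero, add_zero]
    ring
  rw [e1, div_mul_eq_mul_div, div_le_iff₀ hD]
  have h2 : 0 ≤ w.im ^ 2 * (2 * (m * w.re) + n) ^ 2 := by positivity
  have h3 : 0 ≤ (1 + 2 * w.re ^ 2) * (m * w.re + n) ^ 2 := by positivity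
  have h4 : 0 ≤ w.im ^ 2 * (m * w.im) ^ 2 := by positivity
  nlinarith

/-- `rowFun w` takes equal values at 0 and 1, so it descends to a continuous function on the circle;
its Fourier coefficients are summable, hence its Fourier series converges to it pointwise. -/
theorem hasSum_row {w : ℂ} (hw : 0 < w.im) {v : ℝ} (hv : v ∈ Set.Ico (0 : ℝ) 1) :
    HasSum (fun n : ℤ => e v ^ n / ((‖w + n‖ ^ 2 : ℝ) : ℂ)) (Real.pi / w.im * rowFun w v) := by
  have hw' : 0 < (-(starRingEnd ℂ) w).im := by simpa using hw
  have h1 := one_sub_ne_zero_of_norm_lt_one (norm_e_lt_one hw)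
  have h2 := one_sub_ne_zero_of_norm_lt_one (norm_e_lt_one hw')
  have hper : rowFun w 0 = rowFun w 1 := by
    simp only [rowFun, Complex.ofReal_zero, Complex.ofReal_one, sub_zero, mul_one, sub_self,
      mul_zero, e_zero]
    field_simp
    ring
  let B : C(AddCircle (1 : ℝ), ℂ) := ⟨AddCircle.liftIco 1 0 (rowFun w),
    AddCircle.liftIco_zero_continuous hper (continuous_rowFun w).continuousOn⟩
  have hcoef : ∀ n : ℤ, fourierCoeff B n
      = w.im / Real.pi * (1 / ((‖w + n‖ ^ 2 : ℝ) : ℂ)) := fun n => by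
    rw [← integral_rowFun hw n]
    change fourierCoeff (AddCircle.liftIco 1 0 (rowFun w)) n = _
    rw [fourierCoeff_liftIco_eq, fourierCoeffOn_eq_integral]
    simp only [zero_add, sub_zero, div_one, one_smul, smul_eq_mul]
    refine intervalIntegral.integral_congr fun t _ => ?_
    simp only [fourier_coe_apply, e]
    congr 2
    push_cast; ring
  have hsum : Summable (fourierCoeff B) := by
    rw [funext hcoef]
    obtain ⟨c, hc, hab⟩ := exists_lattice_bound hw
    refine Summable.mul_left _ (Summable.of_norm_bounded
      (summable_one_div_one_add_int_sq.mul_left (2 / c)) fun n => ?_)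
    rw [norm_div, norm_one, Complex.norm_real, Real.norm_of_nonneg (by positivity)]
    simpa using one_div_norm_sq_le hc hab 1 n
  have h := (has_pointwise_sum_fourier_series_of_summable hsum (v : AddCircle (1 : ℝ))).mul_left
    (Real.pi / w.im : ℂ)
  have hBv : B (v : AddCircle (1 : ℝ)) = rowFun w v :=
    AddCircle.liftIco_zero_coe_apply (f := rowFun w) hv
  rw [hBv] at h
  refine h.congr_fun fun n => ?_
  have hpi : (Real.pi : ℂ) ≠ 0 := Complex.ofReal_ne_zero.2 Real.pi_ne_zero
  have him : (w.im : ℂ) ≠ 0 := Complex.ofReal_ne_zero.2 hw.ne'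
  rw [hcoef, fourier_coe_apply, e_zpow, e, smul_eq_mul,
    show 2 * (Real.pi : ℂ) * Complex.I * n * v / ((1 : ℝ) : ℂ)
      = 2 * Real.pi * Complex.I * (n * v) by push_cast; ring]
  field_simp

/-- The term `n = 0` is a division by zero, hence 0, which leaves the Fourier expansion of the
second Bernoulli function. -/
theorem hasSum_row_zero {v : ℝ} (hv : v ∈ Set.Icc (0 : ℝ) 1) :
    HasSum (fun n : ℤ => e v ^ n / ((‖(n : ℂ)‖ ^ 2 : ℝ) : ℂ)) ((2 * Real.pi ^ 2 * B₂ v : ℝ) : ℂ) := by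
  have h := hasSum_one_div_pow_mul_fourier_mul_bernoulliFun le_rfl hv
  convert h using 1
  · ext n
    rw [fourier_coe_apply, e_zpow, e,
      show 2 * (Real.pi : ℂ) * Complex.I * n * v / ((1 : ℝ) : ℂ)
        = 2 * Real.pi * Complex.I * (n * v) by push_cast; ring, Complex.norm_intCast]
    norm_cast
    rw [sq_abs]
    push_cast
    ring
  · rw [bernoulliFun_two, B₂]
    push_cast
    rw [Nat.factorial_two, mul_pow, Complex.I_sq]
    push_cast
    ring

theorem rowSum_neg (a b : ℂ) {ξ : ℂ} (hξ : ‖ξ‖ = 1) (m : ℤ) :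
    rowSum a b ξ (-m) = (starRingEnd ℂ) (rowSum a b ξ m) := by
  rw [rowSum, rowSum, Complex.conj_tsum, ← (Equiv.neg ℤ).tsum_eq]
  refine tsum_congr fun n => ?_
  have h : (starRingEnd ℂ) ξ = ξ⁻¹ := (Complex.inv_eq_conj hξ).symm
  rw [Equiv.neg_apply, map_div₀, map_zpow₀, h, Complex.conj_ofReal, inv_zpow',
    ← norm_neg]
  push_cast
  ring_nf

theorem rowSum_of_pos {w : ℂ} (hw : 0 < w.im) {v : ℝ} (hv : v ∈ Set.Ico (0 : ℝ) 1) {m : ℤ}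
    (hm : 0 < m) :
    rowSum w 1 (e v) m = Real.pi / (m * w.im) * rowFun (m * w) v := by
  have hm' : (0 : ℝ) < m := by exact_mod_cast hm
  have him : ((m : ℂ) * w).im = m * w.im := by simp
  have h := (hasSum_row (w := m * w) (by rw [him]; positivity) hv).tsum_eq
  rw [him] at h
  simpa [rowSum] using h

theorem rowSum_zero (w : ℂ) {v : ℝ} (hv : v ∈ Set.Icc (0 : ℝ) 1) :
    rowSum w 1 (e v) 0 = ((2 * Real.pi ^ 2 * B₂ v : ℝ) : ℂ) := by
  rw [← (hasSum_row_zero hv).tsum_eq]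
  simp [rowSum]

/-! ### Euler products and their logarithms. -/

/-- The product `∏ (1 - qᵏ w)` over `k ≥ 0`. -/
noncomputable def eulerProd (q w : ℂ) : ℂ := ∏' k : ℕ, (1 - q ^ k * w)

theorem summable_norm_pow_mul {q : ℂ} (hq : ‖q‖ < 1) (w : ℂ) :
    Summable fun k : ℕ => ‖-(q ^ k * w)‖ := by
  simpa [norm_mul] using (summable_geometric_of_lt_one (norm_nonneg q) hq).mul_right ‖w‖

theorem multipliable_eulerProd {q : ℂ} (hq : ‖q‖ < 1) (w : ℂ) :
    Multipliable fun k : ℕ => 1 - q ^ k * w := by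
  simpa [sub_eq_add_neg] using multipliable_one_add_of_summable (summable_norm_pow_mul hq w)

theorem eulerProd_eq {q : ℂ} (hq : ‖q‖ < 1) (w : ℂ) :
    eulerProd q w = (1 - w) * eulerProd q (q * w) := by
  have h : ∀ k : ℕ, 1 - q ^ (k + 1) * w = 1 - q ^ k * (q * w) := fun k => by ring
  have := tprod_eq_zero_mul' (f := fun k : ℕ => 1 - q ^ k * w)
    (by simp_rw [h]; exact multipliable_eulerProd hq _)
  simp_rw [h] at this
  simpa [eulerProd] using this

theorem eulerProd_ne_zero {q : ℂ} (hq : ‖q‖ < 1) {w : ℂ} (hw : ‖w‖ < 1) : eulerProd q w ≠ 0 := by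
  have := tprod_one_add_ne_zero_of_summable (f := fun k : ℕ => -(q ^ k * w)) (fun k => ?_)
    (summable_norm_pow_mul hq w)
  · simpa [sub_eq_add_neg, eulerProd] using this
  · rw [← sub_eq_add_neg]
    refine one_sub_ne_zero_of_norm_lt_one ?_
    rw [norm_mul, norm_pow]
    exact (mul_le_of_le_one_left (norm_nonneg _) (pow_le_one₀ (norm_nonneg _) hq.le)).trans_lt hw

theorem continuous_eulerProd {q : ℂ} (hq : ‖q‖ < 1) : Continuous (eulerProd q) := by
  rw [continuous_iff_continuousAt]
  intro w₀
  have hK : IsOpen (Metric.ball (0 : ℂ) (‖w₀‖ + 1)) := Metric.isOpen_ball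
  have h := Summable.hasProdLocallyUniformlyOn_nat_one_add
    (f := fun (k : ℕ) (w : ℂ) => -(q ^ k * w)) hK ((summable_geometric_of_lt_one (norm_nonneg q) hq).mul_right (‖w₀‖ + 1))
    (Eventually.of_forall fun n w hw => by
      rw [norm_neg, norm_mul, norm_pow]
      gcongr
      exact (mem_ball_zero_iff.1 hw).le) (fun n => by fun_prop)
  have h2 := TendstoLocallyUniformlyOn.continuousOn h
    (Eventually.frequently (Eventually.of_forall fun s => by fun_prop))
  simp only [← sub_eq_add_neg] at h2
  exact h2.continuousAt (hK.mem_nhds (by simp))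

/-- Expand each `-log(1 - qᵏα)` in its Taylor series and exchange the absolutely convergent sums:
the sum over `k` is geometric. Taking real parts makes the branch of the logarithm irrelevant. -/
theorem hasSum_log_eulerProd {q α : ℂ} (hq : ‖q‖ < 1) (hα : ‖α‖ < 1) :
    HasSum (fun m : ℕ => (α ^ (m + 1) / ((m + 1) * (1 - q ^ (m + 1)))).re)
      (-Real.log ‖eulerProd q α‖) := by
  have hqα : ∀ k : ℕ, ‖q ^ k * α‖ < 1 := fun k => by
    rw [norm_mul, norm_pow]
    exact (mul_le_of_le_one_left (norm_nonneg _) (pow_le_one₀ (norm_nonneg _) hq.le)).trans_lt hα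
  obtain ⟨f, hf_def⟩ : ∃ f : ℕ × ℕ → ℂ, ∀ p, f p = (q ^ p.2 * α) ^ (p.1 + 1) / (p.1 + 1) :=
    ⟨_, fun _ => rfl⟩
  have hf : Summable f := by
    refine Summable.of_norm_bounded
      ((summable_geometric_of_lt_one (norm_nonneg α) hα).mul_of_nonneg
        (summable_geometric_of_lt_one (norm_nonneg q) hq) (fun _ => pow_nonneg (norm_nonneg _) _)
        (fun _ => pow_nonneg (norm_nonneg _) _)) ?_
    rintro ⟨m, k⟩
    have h1 : (1 : ℝ) ≤ ‖((m : ℂ) + 1)‖ := by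
      rw [← Nat.cast_succ, Complex.norm_natCast]
      exact_mod_cast Nat.succ_pos m
    rw [hf_def, norm_div, norm_pow, norm_mul, norm_pow, mul_pow]
    refine (div_le_self (by positivity) h1).trans ?_
    rw [mul_comm]
    have h2 : ‖α‖ ^ (m + 1) ≤ ‖α‖ ^ m := pow_le_pow_of_le_one (norm_nonneg _) hα.le m.le_succ
    have h3 : (‖q‖ ^ k) ^ (m + 1) ≤ ‖q‖ ^ k := by
      rw [pow_succ]
      exact mul_le_of_le_one_left (by positivity)
        (pow_le_one₀ (by positivity) (pow_le_one₀ (norm_nonneg _) hq.le))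
    exact mul_le_mul h2 h3 (by positivity) (by positivity)
  have hrow : ∀ m : ℕ, HasSum (fun k => f (m, k)) (α ^ (m + 1) / ((m + 1) * (1 - q ^ (m + 1)))) := by
    intro m
    have hqm : ‖q ^ (m + 1)‖ < 1 := by
      rw [norm_pow]; exact pow_lt_one₀ (norm_nonneg _) hq (Nat.succ_ne_zero m)
    have h := (hasSum_geometric_of_norm_lt_one hqm).mul_left (α ^ (m + 1) / ((m : ℂ) + 1))
    rw [← div_eq_mul_inv, div_div] at h
    refine h.congr_fun fun k => ?_
    rw [hf_def, ← pow_mul, mul_pow, ← pow_mul, mul_comm (m + 1) k]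
    ring
  have hcol : ∀ k : ℕ, HasSum (fun m => f (m, k)) (-Complex.log (1 - q ^ k * α)) := fun k => by
    simp_rw [hf_def]
    exact Complex.hasSum_taylorSeries_neg_log' (hqα k)
  have hsum : Summable fun k : ℕ => Complex.log (1 - q ^ k * α) :=
    Summable.clog_one_sub (by simpa using (summable_norm_pow_mul hq α).of_norm.neg)
  have h1 : HasSum (fun m : ℕ => α ^ (m + 1) / ((m + 1) * (1 - q ^ (m + 1)))) (∑' p, f p) :=
    hf.hasSum.prod_fiberwise hrow
  have h2 : HasSum (fun k : ℕ => -Complex.log (1 - q ^ k * α)) (∑' p, f p) :=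
    ((Equiv.prodComm ℕ ℕ).hasSum_iff.2 hf.hasSum).prod_fiberwise hcol
  have h3 : ∑' p, f p = -∑' k : ℕ, Complex.log (1 - q ^ k * α) := h2.unique hsum.hasSum.neg
  have h4 : Complex.exp (∑' k : ℕ, Complex.log (1 - q ^ k * α)) = eulerProd q α :=
    Complex.cexp_tsum_eq_tprod (fun k => one_sub_ne_zero_of_norm_lt_one (hqα k)) hsum
  rw [← h4, Complex.norm_exp, Real.log_exp, ← Complex.neg_re, ← h3]
  exact Complex.hasSum_re h1

/-! ### The absolute value of the Siegel function. -/

theorem norm_siegel (a₁ a₂ : ℝ) (τ : ℍ) :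
    ‖siegel a₁ a₂ τ‖ = Real.exp (-(Real.pi * τ.im * B₂ a₁)) *
      (‖eulerProd (e τ) (e (a₁ * τ + a₂))‖ * ‖eulerProd (e τ) (e τ / e (a₁ * τ + a₂))‖) := by
  have hq : ‖e τ‖ < 1 := norm_e_lt_one τ.im_pos
  set q := e τ
  set w := e (a₁ * τ + a₂)
  have h1 : ∀ n : ℕ, (1 - q ^ (n + 1) * w) * (1 - q ^ (n + 1) / w)
      = (1 - q ^ n * (q * w)) * (1 - q ^ n * (q / w)) := fun n => by ring
  have h2 : (1 - w) * ∏' n : ℕ, ((1 - q ^ (n + 1) * w) * (1 - q ^ (n + 1) / w))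
      = eulerProd q w * eulerProd q (q / w) := by
    simp_rw [h1]
    rw [Multipliable.tprod_mul (multipliable_eulerProd hq _) (multipliable_eulerProd hq _),
      eulerProd_eq hq w, mul_assoc]
    rfl
  rw [siegel, mul_assoc, h2, norm_mul, norm_mul, norm_mul, norm_neg, norm_e_ofReal, norm_e, mul_one]
  congr 2
  simp
  ring

/-- The shift trades a factor `1 - w` of one Euler product for a factor `1 - 1/w` of the other; the
discrepancy `‖w‖` is absorbed by `B₂(a₁ + 1) - B₂(a₁) = 2a₁`. -/
theorem norm_siegel_add_one (a₁ a₂ : ℝ) (τ : ℍ) : ‖siegel (a₁ + 1) a₂ τ‖ = ‖siegel a₁ a₂ τ‖ := by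
  have hq : ‖e τ‖ < 1 := norm_e_lt_one τ.im_pos
  have hw : e (((a₁ + 1 : ℝ) : ℂ) * τ + a₂) = e τ * e (a₁ * τ + a₂) := by
    rw [← e_add]; push_cast; ring_nf
  have hq0 := e_ne_zero τ
  have hw0 := e_ne_zero (a₁ * τ + a₂)
  have hnw : ‖e (a₁ * τ + a₂)‖ = Real.exp (-(2 * Real.pi * (a₁ * τ.im))) := by
    rw [norm_e]; simp
  rw [norm_siegel, norm_siegel, hw]
  set q := e τ
  set w := e (a₁ * τ + a₂)
  have h1 : q / (q * w) = 1 / w := by field_simp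
  have h2 : q * (1 / w) = q / w := by ring
  rw [h1, eulerProd_eq hq (1 / w), h2, eulerProd_eq hq w, norm_mul, norm_mul]
  have h3 : ‖1 - w‖ = ‖w‖ * ‖1 - 1 / w‖ := by
    rw [← norm_mul, mul_sub, mul_one_div_cancel hw0, mul_one, norm_sub_rev]
  have h4 : Real.exp (-(Real.pi * τ.im * B₂ (a₁ + 1)))
      = Real.exp (-(Real.pi * τ.im * B₂ a₁)) * ‖w‖ := by
    rw [hnw, ← Real.exp_add, B₂, B₂]; ring_nf
  rw [h3, h4]
  ring

theorem norm_siegel_add_int (a₁ a₂ : ℝ) (τ : ℍ) (k : ℤ) :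
    ‖siegel (a₁ + k) a₂ τ‖ = ‖siegel a₁ a₂ τ‖ := by
  induction k with
  | zero => simp
  | succ k ih => rw [← ih, ← norm_siegel_add_one (a₁ + (k : ℤ))]; push_cast; ring_nf
  | pred k ih => rw [← ih, ← norm_siegel_add_one]; push_cast; ring_nf

theorem continuous_norm_siegel (a₂ : ℝ) (τ : ℍ) : Continuous fun a₁ => ‖siegel a₁ a₂ τ‖ := by
  have h1 := continuous_eulerProd (norm_e_lt_one τ.im_pos : ‖e τ‖ < 1)
  have h2 := continuous_e
  simp_rw [norm_siegel, B₂]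
  have h3 : Continuous fun a₁ : ℝ => e τ / e (a₁ * τ + a₂) :=
    Continuous.div (by fun_prop) (by fun_prop) fun _ => e_ne_zero _
  fun_prop

theorem norm_siegel_zero_ne_zero {a₂ : ℝ} (ha : ¬∃ k : ℤ, a₂ = k) (τ : ℍ) :
    ‖siegel 0 a₂ τ‖ ≠ 0 := by
  have hq : ‖e τ‖ < 1 := norm_e_lt_one τ.im_pos
  have hw : e (((0 : ℝ) : ℂ) * τ + a₂) = e a₂ := by simp
  rw [norm_siegel, hw, eulerProd_eq hq (e a₂)]
  refine mul_ne_zero (Real.exp_ne_zero _) (mul_ne_zero (norm_ne_zero_iff.2 (mul_ne_zero ?_ ?_))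
    (norm_ne_zero_iff.2 ?_))
  · exact sub_ne_zero.2 fun h => ha (e_ofReal_eq_one_iff.1 h.symm)
  · exact eulerProd_ne_zero hq (by rwa [norm_mul, norm_e_ofReal, mul_one])
  · exact eulerProd_ne_zero hq (by rwa [norm_div, norm_e_ofReal, div_one])

/-- For `0 < v < 1` both Euler products can be given arguments inside the unit disc, where
`hasSum_log_eulerProd` applies. The price is a factor `‖β‖⁻¹`, which turns `B₂(-v) = B₂(v) + 2v`
into `B₂(v)`. -/
theorem log_norm_siegel (τ : ℍ) (u : ℝ) {v : ℝ} (hv : v ∈ Set.Ioo (0 : ℝ) 1) :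
    Real.log ‖siegel (-v) u τ‖ = -(Real.pi * τ.im * B₂ v)
      + (Real.log ‖eulerProd (e τ) (e (u + τ * (1 - v)))‖
        + Real.log ‖eulerProd (e τ) (e (-u + τ * v))‖) := by
  have hq : ‖e τ‖ < 1 := norm_e_lt_one τ.im_pos
  have hτ := τ.im_pos
  have hα : ‖e (u + τ * (1 - v))‖ < 1 := norm_e_lt_one (by
    simpa using mul_pos hτ (sub_pos.2 hv.2))
  have hβ : ‖e (-u + τ * v)‖ < 1 := norm_e_lt_one (by simpa using mul_pos hτ hv.1)
  have hα' : e τ * e (((-v : ℝ) : ℂ) * τ + u) = e (u + τ * (1 - v)) := by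
    rw [← e_add]; push_cast; ring_nf
  have hβ' : e (((-v : ℝ) : ℂ) * τ + u) = (e (-u + τ * v))⁻¹ := by
    rw [← e_neg]; push_cast; ring_nf
  have hβ0 := e_ne_zero (-u + τ * v)
  rw [norm_siegel, eulerProd_eq hq (e (((-v : ℝ) : ℂ) * τ + u)), hα', hβ', div_inv_eq_mul]
  have hnβ : ‖e (-u + τ * v)‖ = Real.exp (-(2 * Real.pi * (τ.im * v))) := by
    rw [norm_e]; simp
  have h1 := eulerProd_eq hq (e (-u + τ * v))
  have h0 := eulerProd_ne_zero hq hα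
  have h00 := eulerProd_ne_zero hq hβ
  set α := e (u + τ * (1 - v))
  set β := e (-u + τ * v)
  set q := e τ
  have h2 : ‖1 - β⁻¹‖ = ‖β‖⁻¹ * ‖1 - β‖ := by
    rw [← norm_inv, ← norm_mul, mul_sub, inv_mul_cancel₀ hβ0, mul_one, norm_sub_rev]
  have h3 : ‖(1 - β⁻¹) * eulerProd q α‖ * ‖eulerProd q (q * β)‖
      = ‖β‖⁻¹ * (‖eulerProd q α‖ * ‖eulerProd q β‖) := by
    rw [norm_mul, h2, h1, norm_mul]; ring
  rw [h3, Real.log_mul (Real.exp_ne_zero _), Real.log_mul, Real.log_mul, Real.log_inv, hnβ,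
    Real.log_exp, Real.log_exp, B₂, B₂]
  · ring
  all_goals positivity

/-! ### From the lattice to pairs of integers. -/

/-- The coordinates on the lattice `ℤτ ⊕ ℤ`. -/
noncomputable def latticeEquiv (τ : ℍ) : ℤ × ℤ ≃ lattice τ :=
  Equiv.ofBijective (fun p => p.1 • tauΛ τ + p.2 • oneΛ τ) <| by
    constructor
    · rintro ⟨m, n⟩ ⟨m', n'⟩ h
      have h' := congrArg (fun μ : lattice τ => (μ : ℂ)) h
      simp only [AddSubgroup.coe_add, AddSubgroup.coe_zsmul, tauΛ, oneΛ, zsmul_eq_mul,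
        mul_one] at h'
      have him := congrArg Complex.im h'
      simp only [Complex.add_im, Complex.mul_im, Complex.intCast_re, Complex.intCast_im, zero_mul,
        add_zero, UpperHalfPlane.coe_im] at him
      have hm : m = m' := by exact_mod_cast mul_right_cancel₀ τ.im_pos.ne' him
      subst hm
      have hn : n = n' := by exact_mod_cast add_left_cancel h'
      rw [hn]
    · rintro ⟨μ, hμ⟩
      obtain ⟨n, m, rfl⟩ := AddSubgroup.mem_closure_pair.1 hμ
      refine ⟨(m, n), Subtype.ext ?_⟩
      simp [tauΛ, oneΛ, add_comm]

theorem Z_eq_tsum (τ : ℍ) (ψ : AddChar (lattice τ) Circle) (x : ℝ) :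
    Z τ ψ x = ∑' p : ℤ × ℤ, truncTerm τ 1 (ψ (tauΛ τ)) (ψ (oneΛ τ)) x p.1 p.2 := by
  have h1 : Z τ ψ x = ∑' μ : lattice τ,
      if ‖(μ : ℂ)‖ ^ 2 ≤ x then (ψ μ : ℂ) / ((‖(μ : ℂ)‖ ^ 2 : ℝ) : ℂ) else 0 := by
    rw [Z, tsum_eq_sum (s := (finite_lattice_disc τ x).toFinset)]
    · refine Finset.sum_congr rfl fun μ hμ => ?_
      rw [Set.Finite.mem_toFinset] at hμ
      rw [if_pos hμ.2]
    · intro μ hμ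
      rw [Set.Finite.mem_toFinset] at hμ
      by_cases h0 : μ = 0
      -- The excluded point `μ = 0` contributes nothing, since division by zero gives 0.
      · subst h0; simp
      · exact if_neg fun h => hμ ⟨h0, h⟩
  rw [h1, ← (latticeEquiv τ).tsum_eq]
  refine tsum_congr fun p => ?_
  have hc : ((latticeEquiv τ p : lattice τ) : ℂ) = p.1 * τ + p.2 * 1 := by
    simp [latticeEquiv, tauΛ, oneΛ]
  have hψ : (ψ (latticeEquiv τ p) : ℂ)
      = (ψ (tauΛ τ) : ℂ) ^ p.1 * (ψ (oneΛ τ) : ℂ) ^ p.2 := by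
    change (ψ (p.1 • tauΛ τ + p.2 • oneΛ τ) : ℂ) = _
    rw [AddChar.map_add_eq_mul, AddChar.map_zsmul_eq_zpow, AddChar.map_zsmul_eq_zpow,
      Circle.coe_mul, Circle.coe_zpow, Circle.coe_zpow]
  rw [hc, hψ, truncTerm]

theorem tsum_truncTerm_swap (a b ζ ξ : ℂ) (x : ℝ) :
    ∑' p : ℤ × ℤ, truncTerm a b ζ ξ x p.1 p.2 = ∑' p : ℤ × ℤ, truncTerm b a ξ ζ x p.1 p.2 := by
  rw [← (Equiv.prodComm ℤ ℤ).tsum_eq]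
  refine tsum_congr fun p => ?_
  change truncTerm a b ζ ξ x p.2 p.1 = _
  simp only [truncTerm, add_comm ((p.2 : ℂ) * a), mul_comm (ζ ^ p.2)]

/-! ### The limit formula, by rows and by columns. -/

theorem tendsto_of_v_not_int (τ : ℍ) (u : ℝ) {v : ℝ} (hv : e v ≠ 1) :
    Tendsto (fun x => ∑' p : ℤ × ℤ, truncTerm τ 1 (e u) (e v) x p.1 p.2) atTop
      (𝓝 (∑' m : ℤ, e u ^ m * rowSum τ 1 (e v) m)) := by
  obtain ⟨c, hc, hab⟩ := exists_lattice_bound τ.im_pos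
  exact tendsto_tsum_truncTerm hc hab (norm_e_ofReal u) (norm_e_ofReal v) hv

theorem exists_lattice_bound_swap (τ : ℍ) : ∃ c : ℝ, 0 < c ∧
    ∀ m n : ℤ, c * ((m : ℝ) ^ 2 + (n : ℝ) ^ 2) ≤ ‖m * (1 : ℂ) + n * τ‖ ^ 2 := by
  obtain ⟨c, hc, hab⟩ := exists_lattice_bound τ.im_pos
  refine ⟨c, hc, fun m n => ?_⟩
  rw [add_comm, add_comm ((m : ℂ) * 1)]
  exact hab n m

theorem tendsto_of_u_not_int (τ : ℍ) {u : ℝ} (hu : e u ≠ 1) (v : ℝ) :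
    Tendsto (fun x => ∑' p : ℤ × ℤ, truncTerm τ 1 (e u) (e v) x p.1 p.2) atTop
      (𝓝 (∑' n : ℤ, e v ^ n * rowSum 1 τ (e u) n)) := by
  obtain ⟨c, hc, hab⟩ := exists_lattice_bound_swap τ
  simp_rw [tsum_truncTerm_swap (τ : ℂ) 1]
  exact tendsto_tsum_truncTerm hc hab (norm_e_ofReal v) (norm_e_ofReal u) hu

theorem continuous_columns (τ : ℍ) {u : ℝ} (hu : e u ≠ 1) :
    Continuous fun v : ℝ => ∑' n : ℤ, e v ^ n * rowSum 1 τ (e u) n := by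
  obtain ⟨c, hc, hab⟩ := exists_lattice_bound_swap τ
  obtain ⟨K, hK⟩ := exists_norm_rowSum_le hc hab (norm_e_ofReal u) hu
  refine continuous_tsum (fun n => ?_) (summable_one_div_one_add_int_sq.mul_left K) fun n v => ?_
  · have := continuous_e
    simp_rw [e_zpow]
    fun_prop
  · rw [norm_mul, norm_zpow, norm_e_ofReal, one_zpow, one_mul]
    exact hK n

theorem e_ne_one_of_mem_Ioo {v : ℝ} (hv : v ∈ Set.Ioo (0 : ℝ) 1) : e v ≠ 1 := by
  rw [Ne, e_ofReal_eq_one_iff]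
  rintro ⟨n, rfl⟩
  have h1 : 0 < n := by exact_mod_cast hv.1
  have h2 : n < 1 := by exact_mod_cast hv.2
  omega

/-- The Kronecker limit formula for the lattice sum taken row by row. -/
theorem tsum_rows_eq (τ : ℍ) (u : ℝ) {v : ℝ} (hv : v ∈ Set.Ioo (0 : ℝ) 1) :
    ∑' m : ℤ, e u ^ m * rowSum τ 1 (e v) m
      = ((-(2 * Real.pi) / τ.im * Real.log ‖siegel (-v) u τ‖ : ℝ) : ℂ) := by
  have hτ := τ.im_pos
  have hq : ‖e τ‖ < 1 := norm_e_lt_one hτ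
  have hα : ‖e (u + τ * (1 - v))‖ < 1 := norm_e_lt_one (by
    simpa using mul_pos hτ (sub_pos.2 hv.2))
  have hβ : ‖e (-u + τ * v)‖ < 1 := norm_e_lt_one (by simpa using mul_pos hτ hv.1)
  have hlog := log_norm_siegel τ u hv
  have hαS := hasSum_log_eulerProd hq hα
  have hβS := hasSum_log_eulerProd hq hβ
  set α := e (u + τ * (1 - v)) with hαdef
  set β := e (-u + τ * v) with hβdef
  set x : ℤ → ℂ := fun m => e u ^ m * rowSum τ 1 (e v) m
  have hxs : Summable x := by
    obtain ⟨c, hc, hab⟩ := exists_lattice_bound hτ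
    obtain ⟨K, hK⟩ := exists_norm_rowSum_le hc hab (norm_e_ofReal v) (e_ne_one_of_mem_Ioo hv)
    refine Summable.of_norm_bounded (summable_one_div_one_add_int_sq.mul_left K) fun m => ?_
    rw [norm_mul, norm_zpow, norm_e_ofReal, one_zpow, one_mul]
    exact hK m
  -- Hence the whole sum is `x 0` plus twice the real part of the sum over `m > 0`.
  have hxneg : ∀ m, x (-m) = (starRingEnd ℂ) (x m) := fun m => by
    have h : (starRingEnd ℂ) (e u) = (e u)⁻¹ := (Complex.inv_eq_conj (norm_e_ofReal u)).symm
    simp only [x]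
    rw [rowSum_neg _ _ (norm_e_ofReal v), map_mul, map_zpow₀, h, inv_zpow']
  -- The two terms of `rowFun` give the `α` series and the conjugate of the `β` series; the
  -- conjugation disappears in the real part.
  have hre : ∀ m : ℕ, (x (m + 1)).re = Real.pi / τ.im *
      ((α ^ (m + 1) / ((m + 1) * (1 - e τ ^ (m + 1)))).re
        + (β ^ (m + 1) / ((m + 1) * (1 - e τ ^ (m + 1)))).re) := fun m => by
    have e1 : x (m + 1) = (Real.pi / τ.im : ℝ) * (α ^ (m + 1) / ((m + 1) * (1 - e τ ^ (m + 1)))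
        + (starRingEnd ℂ) (β ^ (m + 1) / ((m + 1) * (1 - e τ ^ (m + 1))))) := by
      have a1 : e u ^ ((m : ℤ) + 1) * e (((m : ℂ) + 1) * τ * (1 - v)) = α ^ (m + 1) := by
        rw [hαdef, e_pow, e_zpow, ← e_add]; push_cast; ring_nf
      have a2 : e u ^ ((m : ℤ) + 1) * e (-(starRingEnd ℂ) (((m : ℂ) + 1) * τ) * v)
          = (starRingEnd ℂ) (β ^ (m + 1)) := by
        rw [hβdef, e_pow, e_zpow, conj_e, ← e_add]
        simp
        ring_nf
      have a3 : e (((m : ℂ) + 1) * τ) = e τ ^ (m + 1) := by rw [e_pow]; push_cast; ring_nf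
      have a4 : e (-(starRingEnd ℂ) (((m : ℂ) + 1) * τ)) = (starRingEnd ℂ) (e τ ^ (m + 1)) := by
        rw [← a3, conj_e]
      simp only [x]
      rw [rowSum_of_pos hτ ⟨hv.1.le, hv.2⟩ (by positivity), rowFun]
      push_cast
      rw [a4, map_div₀, ← a2, a3, ← a1]
      simp only [map_mul, map_sub, map_one, map_add, map_natCast, UpperHalfPlane.coe_im]
      have alg : ∀ E p M y A B C D : ℂ, E * (p / (M * y) * (A / C + B / D))
          = p / y * (E * A / (M * C) + E * B / (M * D)) := by intros; ring
      exact alg _ _ _ _ _ _ _ _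
    rw [e1, Complex.re_ofReal_mul, Complex.add_re, Complex.conj_re]
  have hpos : Summable fun m : ℕ => x (m + 1) :=
    hxs.comp_injective (i := fun m : ℕ => (m : ℤ) + 1) fun a b h => by simpa using h
  have hneg : Summable fun m : ℕ => x (-(m + 1)) :=
    hxs.comp_injective (i := fun m : ℕ => -((m : ℤ) + 1)) fun a b h => by simpa using h
  have hS : (∑' m : ℕ, x (m + 1)).re
      = Real.pi / τ.im * (-Real.log ‖eulerProd (e τ) α‖ + -Real.log ‖eulerProd (e τ) β‖) := by
    rw [Complex.re_tsum hpos]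
    simp_rw [hre]
    exact ((hαS.add hβS).mul_left _).tsum_eq
  have h0 : x 0 = ((2 * Real.pi ^ 2 * B₂ v : ℝ) : ℂ) := by
    simp only [x, zpow_zero, one_mul]
    exact rowSum_zero _ ⟨hv.1.le, hv.2.le⟩
  rw [tsum_of_add_one_of_neg_add_one hpos hneg]
  simp_rw [hxneg]
  rw [← Complex.conj_tsum, h0, add_right_comm, Complex.add_conj, hS, hlog, ← Complex.ofReal_add]
  congr 1
  field_simp
  ring

/-- The columnwise sum equals the limit formula, including at the boundary `v = 0`. -/
theorem tsum_columns_zero_eq (τ : ℍ) {u : ℝ} (hu : e u ≠ 1) :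
    ∑' n : ℤ, e (0 : ℝ) ^ n * rowSum 1 τ (e u) n
      = ((-(2 * Real.pi) / τ.im * Real.log ‖siegel (-0) u τ‖ : ℝ) : ℂ) := by
  have h1 : Tendsto (fun v : ℝ => ∑' n : ℤ, e v ^ n * rowSum 1 τ (e u) n) (𝓝[>] 0)
      (𝓝 (∑' n : ℤ, e (0 : ℝ) ^ n * rowSum 1 τ (e u) n)) :=
    (continuous_columns τ hu).continuousAt.tendsto.mono_left nhdsWithin_le_nhds
  have hne : ‖siegel (-0) u τ‖ ≠ 0 := by
    rw [neg_zero]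
    exact norm_siegel_zero_ne_zero (fun h => hu (e_ofReal_eq_one_iff.2 h)) τ
  have h2 : Tendsto
      (fun v : ℝ => ((-(2 * Real.pi) / τ.im * Real.log ‖siegel (-v) u τ‖ : ℝ) : ℂ)) (𝓝[>] 0)
      (𝓝 ((-(2 * Real.pi) / τ.im * Real.log ‖siegel (-0) u τ‖ : ℝ) : ℂ)) := by
    have hc : ContinuousAt (fun v : ℝ => ‖siegel (-v) u τ‖) 0 :=
      ((continuous_norm_siegel u τ).comp continuous_neg).continuousAt
    have hl := (hc.log hne).const_mul (-(2 * Real.pi) / τ.im)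
    exact (Complex.continuous_ofReal.continuousAt.comp hl).tendsto.mono_left nhdsWithin_le_nhds
  refine tendsto_nhds_unique h1 (h2.congr' ?_)
  -- For `v` in `(0, 1)` the row sum and the column sum are both the limit over discs, so they
  -- coincide.
  filter_upwards [Ioo_mem_nhdsGT (zero_lt_one (α := ℝ))] with v hv
  rw [← tsum_rows_eq τ u hv]
  exact tendsto_nhds_unique (tendsto_of_v_not_int τ u (e_ne_one_of_mem_Ioo hv))
    (tendsto_of_u_not_int τ hu v)

theorem tendsto_tsum_of_mem_Ico (τ : ℍ) (u : ℝ) {v : ℝ} (hv : v ∈ Set.Ico (0 : ℝ) 1)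
    (huv : e u ≠ 1 ∨ v ≠ 0) :
    Tendsto (fun x => ∑' p : ℤ × ℤ, truncTerm τ 1 (e u) (e v) x p.1 p.2) atTop
      (𝓝 ((-(2 * Real.pi) / τ.im * Real.log ‖siegel (-v) u τ‖ : ℝ) : ℂ)) := by
  rcases hv.1.eq_or_lt with rfl | h0
  · have hu := huv.resolve_right (by simp)
    rw [← tsum_columns_zero_eq τ hu]
    exact tendsto_of_u_not_int τ hu 0
  · rw [← tsum_rows_eq τ u ⟨h0, hv.2⟩]
    exact tendsto_of_v_not_int τ u (e_ne_one_of_mem_Ioo ⟨h0, hv.2⟩)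

end LatticeSum

theorem mainTheorem10 (τ : ℍ) (ψ : AddChar (LatticeSum.lattice τ) Circle) (u v : ℝ)
    (huv : ¬ ((∃ k : ℤ, u = k) ∧ (∃ l : ℤ, v = l)))
    (hτ : (ψ (LatticeSum.tauΛ τ) : ℂ) = Complex.exp (2 * Real.pi * Complex.I * u))
    (h1 : (ψ (LatticeSum.oneΛ τ) : ℂ) = Complex.exp (2 * Real.pi * Complex.I * v)) :
    Tendsto (LatticeSum.Z τ ψ) atTop (𝓝 (LatticeSum.L τ ψ)) ∧
      LatticeSum.L τ ψ =
        ((-(2 * Real.pi) / τ.im * Real.log ‖LatticeSum.siegel (-v) u τ‖ : ℝ) : ℂ) := by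
  -- Both sides depend on `v` only modulo 1, which reduces to `0 ≤ v < 1`.
  have hv : LatticeSum.e v = LatticeSum.e (Int.fract v : ℝ) := by
    conv_lhs => rw [← Int.floor_add_fract v]
    push_cast
    rw [LatticeSum.e_add, LatticeSum.e_int, one_mul]
  have hg : ‖LatticeSum.siegel (-v) u τ‖ = ‖LatticeSum.siegel (-Int.fract v) u τ‖ := by
    rw [← LatticeSum.norm_siegel_add_int (-v) u τ ⌊v⌋, Int.fract, neg_sub', sub_neg_eq_add]
  have hdisj : LatticeSum.e u ≠ 1 ∨ Int.fract v ≠ 0 := by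
    by_contra! h
    refine huv ⟨LatticeSum.e_ofReal_eq_one_iff.1 h.1, ⌊v⌋, ?_⟩
    have := Int.floor_add_fract v
    rw [h.2, add_zero] at this
    exact this.symm
  have hZ : Tendsto (LatticeSum.Z τ ψ) atTop (𝓝
      ((-(2 * Real.pi) / τ.im * Real.log ‖LatticeSum.siegel (-v) u τ‖ : ℝ) : ℂ)) := by
    have h := LatticeSum.tendsto_tsum_of_mem_Ico τ u
      ⟨Int.fract_nonneg v, Int.fract_lt_one v⟩ hdisj
    rw [hg]
    refine h.congr fun x => ?_
    rw [LatticeSum.Z_eq_tsum, hτ, h1, ← hv]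
    rfl
  have hL : LatticeSum.L τ ψ = _ := hZ.limUnder_eq
  exact ⟨hL ▸ hZ, hL⟩
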